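/- Let $\mathbb{D}=\{z\in\mathbb{C}:|z|<1\}$. For analytic functions $f,g$ on $\mathbb{D}$, write $f\prec g$ ($f$ is subordinate to $g$) if there is an analytic function $w$ on $\mathbb{D}$ with $w(0)=0$ and $|w(z)|<1$ such that $f(z)=g(w(z))$ for all $z\in\mathbb{D}$. Let $$\varphi_{Ne}(z)=1+z-\frac{z^3}{3},\qquad \varphi_{RL}(z)=\sqrt2-(\sqrt2-1)\sqrt{\frac{1-z}{1+2(\sqrt2-1)z}}\qquad(z\in\mathbb{D}),$$ with the principal branch of the square root, and for $x\in[-1,1]$ let $$g_0(x)=\sqrt{2(\sqrt2-1)}\;\arctan\!\left(\frac{\sqrt{2(\sqrt2-1)}\,\bigl(\sqrt{2(\sqrt2-1)x+1}-\sqrt{1-x}\bigr)}{2(\sqrt2-1)\sqrt{1-x}+\sqrt{2(\sqrt2-1)x+1}}\right).$$ Put $$\beta_0=-\frac32\Bigl(2(\sqrt2-1)\log\bigl(\tfrac12(\sqrt{1-2(\sqrt2-1)}+\sqrt2)\bigr)+g_0(-1)\Bigr),$$ $$\beta_1=\frac{2(\sqrt2-1)\log\bigl(\tfrac12\sqrt{2(\sqrt2-1)+1}\bigr)+g_0(1)}{\log(5/3)},$$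 $$\beta_2=\frac52\Bigl(2(\sqrt2-1)\log\bigl(\tfrac12\sqrt{2(\sqrt2-1)+1}\bigr)+g_0(1)\Bigr).$$ Then for each $j\in\{0,1,2\}$ and each real $\beta\ge\beta_j$: if $p$ is analytic on $\mathbb{D}$ with $p(0)=1$ and $$1+\beta\,\frac{zp'(z)}{p(z)^j}\prec\varphi_{RL}(z),$$ then $p\prec\varphi_{Ne}$. The bounds $\beta_j$ are sharp: for each $j\in\{0,1,2\}$ and each $\beta$ with $0<\beta<\beta_j$ there is an analytic $p$ on $\mathbb{D}$ with $p(0)=1$ that satisfies this differential subordination but not $p\prec\varphi_{Ne}$. To six decimal places, $\beta_0\approx0.822832$, $\beta_1\approx0.680906$ and $\beta_2\approx0.869561$. -/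

import Mathlib

open scoped Real

noncomputable section

namespace Nephroid

/-- The open unit disk of `ℂ`. -/
def disk : Set ℂ := Metric.ball 0 1

/-- Subordination `f ≺ g` of analytic functions on the open unit disk: `f = g ∘ w` on the disk for
some analytic `w` with `w 0 = 0` and `|w| < 1`. Only values on the disk matter. -/
def Subordinate (f g : ℂ → ℂ) : Prop :=
  DifferentiableOn ℂ f disk ∧ DifferentiableOn ℂ g disk ∧
    ∃ w : ℂ → ℂ, DifferentiableOn ℂ w disk ∧ w 0 = 0 ∧ (∀ z ∈ disk, ‖w z‖ < 1) ∧
      ∀ z ∈ disk, f z = g (w z)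

/-- The nephroid map `φ_Ne(z) = 1 + z - z³/3`. -/
def phiNe (z : ℂ) : ℂ := 1 + z - z ^ 3 / 3

/-- The shifted-lemniscate map
`φ_RL(z) = √2 - (√2 - 1) √((1 - z) / (1 + 2(√2 - 1) z))`, with the principal square root. -/
def phiRL (z : ℂ) : ℂ :=
  (√2 : ℝ) - ((√2 : ℝ) - 1) * ((1 - z) / (1 + 2 * ((√2 : ℝ) - 1) * z)) ^ (1 / 2 : ℂ)

/-- The function `g₀` on the real interval `[-1, 1]`. -/
def g0 (x : ℝ) : ℝ :=
  √(2 * (√2 - 1)) *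
    Real.arctan
      (√(2 * (√2 - 1)) * (√(2 * (√2 - 1) * x + 1) - √(1 - x)) /
        (2 * (√2 - 1) * √(1 - x) + √(2 * (√2 - 1) * x + 1)))

/-- For every analytic `p` on the unit disk with `p 0 = 1`, the differential subordination
`1 + β z p'(z) / p(z)^j ≺ φ_RL` implies `p ≺ φ_Ne`.

Subordination includes analyticity of the left side, so for `β ≠ 0` and `j ≥ 1` a function `p` that
vanishes at some point of the disk does not satisfy the hypothesis: the quotient is unbounded near
a zero of `p`. -/
def Implication (j : ℕ) (β : ℝ) : Prop :=
  ∀ p : ℂ → ℂ, DifferentiableOn ℂ p disk → p 0 = 1 →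
    Subordinate (fun z => 1 + (β : ℂ) * (z * deriv p z / p z ^ j)) phiRL → Subordinate p phiNe

/-- The bound for `j = 0`. -/
def betaA : ℝ :=
  -(3 * (2 * (√2 - 1) * Real.log (1 / 2 * (√(1 - 2 * (√2 - 1)) + √2)) + g0 (-1)) / 2)

/-- The bound for `j = 1`. -/
def betaB : ℝ :=
  (2 * (√2 - 1) * Real.log (1 / 2 * √(2 * (√2 - 1) + 1)) + g0 1) / Real.log (5 / 3)

/-- The bound for `j = 2`. -/
def betaC : ℝ :=
  5 * (2 * (√2 - 1) * Real.log (1 / 2 * √(2 * (√2 - 1) + 1)) + g0 1) / 2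

end Nephroid

end

/-!
For `P = p - 1`, `log p`, `1 - 1 / p` (according to `j = 0, 1, 2`) the differential subordination
says `β z P'(z) = φ_RL(w(z)) - 1`, and `|w(z)| ≤ |z|` by the Schwarz lemma. On the disk `|w| ≤ t`
the real part of `φ_RL(w) - 1` lies between its values at `w = -t` and `w = t` (`phiRL_re_mem`), so
integration along the radius to `z` gives `Φ(-|z|) ≤ β Re P(z) ≤ Φ(|z|)`, where `Φ` is the primitive
`Phi` of `(φ_RL(x) - 1) / x` on `[-1, 1]`, known in closed form. The same integration gives a bound
for `Im P` (`bounds_of_mul_deriv_eq`). The constants `β_j` are expressed through `Φ(-1)` and `Φ(1)`,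
and these bounds are just what is needed for the values of `p` to stay strictly between the lines
`Re = 1/3` and `Re = 5/3`.

The points `1/3` and `5/3` are the cusps of the nephroid, and both point inwards. So the domain
`φ_Ne(𝔻)` contains an open rectangle whose vertical sides pass through the cusps
(`rect_subset_phiNe_image`), and the estimates put `p(𝔻)` into that rectangle. As `φ_Ne` is
univalent, this gives `p ≺ φ_Ne` (`subordinate_phiNe_of_mapsTo`). For `j ≥ 1` the function `p` has
no zeros since it solves a linear differential equation with analytic coefficient (`exists_log`).

For sharpness take `w(z) = z`, or `w(z) = ρ z` when `j = 2`, where a smaller `ρ` is needed to avoid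
poles. Then `P` is real on the real axis, equal to `Φ(ρ x) / β` there, and for `β < β_j` the
function `p` attains `1/3` (`j = 0`) or `5/3` (`j = 1, 2`), which are boundary values of the univalent
map `φ_Ne` and hence not values of it on the disk (`not_subordinate_phiNe`).
-/

noncomputable section

namespace Nephroid

open Set Filter Topology

/-! ### The real primitive -/

/-- The integral `∫₀ˣ (φ_RL(t) - 1) / t dt` on `[-1, 1]`, in closed form. -/
def Phi (x : ℝ) : ℝ :=
  2 * (√2 - 1) * Real.log (1 / 2 * (√(2 * (√2 - 1) * x + 1) + √(1 - x))) + g0 x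

/-- The function `φ_RL - 1` on the real interval `(-1, 1)`. -/
def lemR (x : ℝ) : ℝ :=
  (√2 - 1) * (1 - √((1 - x) / (1 + 2 * (√2 - 1) * x)))

/-- The coefficient `2 (√2 - 1)` in the Möbius map under the root of `φ_RL`. -/
def kap : ℝ := 2 * (√2 - 1)

theorem sqrt_two_mem : 1.41421356237 < √2 ∧ √2 < 1.41421356238 :=
  ⟨Real.lt_sqrt_of_sq_lt (by norm_num), (Real.sqrt_lt' (by norm_num)).2 (by norm_num)⟩

theorem kap_mem : 0.82842712474 < kap ∧ kap < 0.82842712476 := by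
  have := sqrt_two_mem
  constructor <;> unfold kap <;> linarith

theorem kap_pos : 0 < kap := lt_trans (by norm_num) kap_mem.1

theorem kap_lt_one : kap < 1 := lt_trans kap_mem.2 (by norm_num)

theorem one_sub_kap : 1 - kap = (√2 - 1) ^ 2 := by
  have := Real.sq_sqrt (show (0 : ℝ) ≤ 2 by norm_num)
  unfold kap
  linarith

theorem one_add_kap_mul_pos {x : ℝ} (hx : -1 ≤ x) : 0 < kap * x + 1 := by
  nlinarith [kap_pos, kap_lt_one]

/-- With `u = √(cx + 1)` and `v = √(1 - x)` one has `u² + c v² = 1 + c`, which collapses the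
derivative of the arctangent to `√c / (2uv)`. -/
theorem hasDerivAt_log_add_arctan {c x : ℝ} (hc : 0 < c) (hx : 0 < c * x + 1) (hx1 : x < 1) :
    HasDerivAt (fun x => c * Real.log (1 / 2 * (√(c * x + 1) + √(1 - x))) +
      √c * Real.arctan (√c * (√(c * x + 1) - √(1 - x)) / (c * √(1 - x) + √(c * x + 1))))
      (c * (1 + c) / (2 * √(c * x + 1) * (√(c * x + 1) + √(1 - x)))) x := by
  have hv0 : 0 < 1 - x := by linarith
  have hu : HasDerivAt (fun x => √(c * x + 1)) (c / (2 * √(c * x + 1))) x := by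
    have := (((hasDerivAt_id x).const_mul c).add_const 1).sqrt (by simpa using hx.ne')
    simpa using this
  have hv : HasDerivAt (fun x => √(1 - x)) (-1 / (2 * √(1 - x))) x := by
    have := ((hasDerivAt_id x).const_sub 1).sqrt (by simpa using hv0.ne')
    simpa using this
  have hu0 : 0 < √(c * x + 1) := Real.sqrt_pos.2 hx
  have hw0 : 0 < √(1 - x) := Real.sqrt_pos.2 hv0
  have hd : 0 < c * √(1 - x) + √(c * x + 1) := by positivity
  have h1 := (((hu.add hv).const_mul (1 / 2)).log (by
    simp only [Pi.add_apply]; positivity)).const_mul c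
  have h2 := ((((hu.sub hv).const_mul (√c)).div ((hv.const_mul c).add hu) hd.ne').arctan).const_mul
    (√c)
  have h3 := h1.add h2
  refine h3.congr_deriv ?_
  have e1 : √(c * x + 1) ^ 2 = c * x + 1 := Real.sq_sqrt hx.le
  have e2 : √(1 - x) ^ 2 = 1 - x := Real.sq_sqrt hv0.le
  have e3 : √c ^ 2 = c := Real.sq_sqrt hc.le
  simp only [Pi.add_apply, Pi.sub_apply, Pi.div_apply]
  generalize √(c * x + 1) = u at *
  generalize √(1 - x) = v at *
  generalize √c = k at *
  have e4 : u ^ 2 + c * v ^ 2 = 1 + c := by rw [e1, e2]; ring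
  have e5 : (c * v + u) ^ 2 + (k * (u - v)) ^ 2 = (1 + c) ^ 2 := by
    rw [mul_pow, e3]
    calc (c * v + u) ^ 2 + c * (u - v) ^ 2 = (1 + c) * (u ^ 2 + c * v ^ 2) := by ring
      _ = (1 + c) ^ 2 := by rw [e4]; ring
  have e6 : 1 + (k * (u - v) / (c * v + u)) ^ 2 = (1 + c) ^ 2 / (c * v + u) ^ 2 := by
    rw [← e5]; field_simp
  have e7 : (k * (c / (2 * u) - -1 / (2 * v))) * (c * v + u) -
      k * (u - v) * (c * (-1 / (2 * v)) + c / (2 * u)) = k * (1 + c) ^ 2 / (2 * u * v) := by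
    have : (1 + c) ^ 2 = (c * v + u) ^ 2 + c * (u - v) ^ 2 := by
      rw [← e5, mul_pow, e3]
    rw [this]; field_simp; ring
  rw [e6, e7]
  have e8 : 1 / ((1 + c) ^ 2 / (c * v + u) ^ 2) * (k * (1 + c) ^ 2 / (2 * u * v) / (c * v + u) ^ 2)
      = k / (2 * u * v) := by
    field_simp
  rw [e8, ← mul_div_assoc k, ← sq, e3]
  field_simp
  ring

theorem Phi_hasDerivAt {x : ℝ} (hx : -1 < x) (hx' : x < 1) :
    HasDerivAt Phi (kap * (1 + kap) / (2 * √(kap * x + 1) * (√(kap * x + 1) + √(1 - x)))) x :=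
  hasDerivAt_log_add_arctan kap_pos (one_add_kap_mul_pos hx.le) hx'

/-- The derivative of `Phi`, multiplied by `x`, is `φ_RL(x) - 1`. -/
theorem Phi_deriv_mul {x : ℝ} (hx : -1 < x) (hx' : x < 1) :
    kap * (1 + kap) / (2 * √(kap * x + 1) * (√(kap * x + 1) + √(1 - x))) * x = lemR x := by
  have h0 := one_add_kap_mul_pos hx.le
  have hu0 : 0 < √(kap * x + 1) := Real.sqrt_pos.2 h0
  have hw0 : 0 < √(1 - x) := Real.sqrt_pos.2 (by linarith)
  have e1 : √(kap * x + 1) ^ 2 = kap * x + 1 := Real.sq_sqrt h0.le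
  have e2 : √(1 - x) ^ 2 = 1 - x := Real.sq_sqrt (by linarith)
  have hk : √2 - 1 = kap / 2 := by unfold kap; ring
  have : lemR x = kap / 2 * (1 - √(1 - x) / √(kap * x + 1)) := by
    rw [lemR, show 1 + 2 * (√2 - 1) * x = kap * x + 1 by unfold kap; ring, hk,
      Real.sqrt_div (by linarith)]
  rw [this]
  generalize √(kap * x + 1) = u at *
  generalize √(1 - x) = v at *
  generalize kap = c at *
  field_simp
  have : x * (1 + c) = u ^ 2 - v ^ 2 := by rw [e1, e2]; ring
  linear_combination c * this

theorem Phi_continuousOn : ContinuousOn Phi (Icc (-1) 1) := by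
  intro x hx
  have h0 : 0 < 2 * (√2 - 1) * x + 1 := one_add_kap_mul_pos hx.1
  have hk : 0 < 2 * (√2 - 1) := kap_pos
  have hu0 : 0 < √(2 * (√2 - 1) * x + 1) := Real.sqrt_pos.2 h0
  have hv : 0 ≤ √(1 - x) := Real.sqrt_nonneg _
  apply ContinuousAt.continuousWithinAt
  unfold Phi g0
  apply ContinuousAt.add
  · refine continuousAt_const.mul (ContinuousAt.log (by fun_prop) (by positivity))
  · refine continuousAt_const.mul (Real.continuous_arctan.continuousAt.comp ?_)
    exact ContinuousAt.div (by fun_prop) (by fun_prop) (by positivity)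

theorem Phi_strictMonoOn : StrictMonoOn Phi (Icc (-1) 1) := by
  refine strictMonoOn_of_deriv_pos (convex_Icc _ _) Phi_continuousOn fun x hx => ?_
  rw [interior_Icc] at hx
  rw [(Phi_hasDerivAt hx.1 hx.2).deriv]
  have := kap_pos
  have hu0 : 0 < √(kap * x + 1) := Real.sqrt_pos.2 (one_add_kap_mul_pos hx.1.le)
  have : 0 ≤ √(1 - x) := Real.sqrt_nonneg _
  positivity

@[simp] theorem Phi_zero : Phi 0 = 0 := by
  norm_num [Phi, g0]

/-! ### Numerical values -/

theorem arctan_bounds {x : ℝ} (hx : 0 ≤ x) :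
    x - x ^ 3 / 3 ≤ Real.arctan x ∧ Real.arctan x ≤ x - x ^ 3 / 3 + x ^ 5 / 5 := by
  constructor
  · have h : MonotoneOn (fun x => Real.arctan x - (x - x ^ 3 / 3)) (Ici 0) := by
      refine monotoneOn_of_hasDerivWithinAt_nonneg (f' := fun y => 1 / (1 + y ^ 2) - (1 - y ^ 2))
        (convex_Ici 0) (by fun_prop) (fun y _ => ?_) fun y _ => ?_
      · have := (Real.hasDerivAt_arctan y).sub
          ((hasDerivAt_id y).sub ((hasDerivAt_pow 3 y).div_const 3))
        refine (this.congr_deriv ?_).hasDerivWithinAt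
        norm_num
      · rw [sub_nonneg, le_div_iff₀ (by positivity)]
        nlinarith [sq_nonneg (y ^ 2)]
    have := h (mem_Ici.2 le_rfl) (mem_Ici.2 hx) hx
    norm_num at this
    linarith
  · have h : MonotoneOn (fun x => (x - x ^ 3 / 3 + x ^ 5 / 5) - Real.arctan x) (Ici 0) := by
      refine monotoneOn_of_hasDerivWithinAt_nonneg
        (f' := fun y => (1 - y ^ 2 + y ^ 4) - 1 / (1 + y ^ 2))
        (convex_Ici 0) (by fun_prop) (fun y _ => ?_) fun y _ => ?_
      · have := (((hasDerivAt_id y).sub ((hasDerivAt_pow 3 y).div_const 3)).add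
          ((hasDerivAt_pow 5 y).div_const 5)).sub (Real.hasDerivAt_arctan y)
        refine (this.congr_deriv ?_).hasDerivWithinAt
        norm_num
      · rw [sub_nonneg, div_le_iff₀ (by positivity)]
        nlinarith [sq_nonneg (y ^ 3)]
    have := h (mem_Ici.2 le_rfl) (mem_Ici.2 hx) hx
    norm_num at this
    linarith

theorem sqrt_kap_mem : 0.91017972111 < √kap ∧ √kap < 0.91017972114 := by
  have := kap_mem
  exact ⟨Real.lt_sqrt_of_sq_lt (lt_of_le_of_lt (by norm_num) this.1),
    (Real.sqrt_lt' (by norm_num)).2 (lt_of_lt_of_le this.2 (by norm_num))⟩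

theorem sqrt_three_mem : 1.73205080756 < √3 ∧ √3 < 1.73205080757 :=
  ⟨Real.lt_sqrt_of_sq_lt (by norm_num), (Real.sqrt_lt' (by norm_num)).2 (by norm_num)⟩

theorem log_sqrt_two_sub_half_mem :
    -0.0896910785 < Real.log (√2 - 1 / 2) ∧ Real.log (√2 - 1 / 2) < -0.0896910775 := by
  have h2 := sqrt_two_mem
  constructor
  · have h := Real.abs_log_sub_add_sum_range_le (x := 0.08578643763) (by norm_num [abs_lt]) 9
    have h' := (abs_le.1 h).1
    have hm : Real.log (1 - 0.08578643763) ≤ Real.log (√2 - 1 / 2) :=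
      Real.log_le_log (by norm_num) (by linarith)
    refine lt_of_lt_of_le ?_ hm
    norm_num [Finset.sum_range_succ, abs_of_pos] at h' ⊢
    linarith
  · have h := Real.abs_log_sub_add_sum_range_le (x := 0.08578643762) (by norm_num [abs_lt]) 9
    have h' := (abs_le.1 h).2
    have hm : Real.log (√2 - 1 / 2) ≤ Real.log (1 - 0.08578643762) :=
      Real.log_le_log (by linarith) (by linarith)
    refine lt_of_le_of_lt hm ?_
    norm_num [Finset.sum_range_succ, abs_of_pos] at h' ⊢
    linarith

theorem arctan_sub_arctan {x y : ℝ} (h : 0 ≤ x * y) :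
    Real.arctan x - Real.arctan y = Real.arctan ((x - y) / (1 + x * y)) := by
  have := Real.arctan_add (x := x) (y := -y) (by nlinarith)
  rw [Real.arctan_neg] at this
  rw [sub_eq_add_neg, this]
  congr 1
  ring

theorem g0_one_mem : 0.67208660 < g0 1 ∧ g0 1 < 0.67208665 := by
  obtain ⟨hk1, hk2⟩ := sqrt_kap_mem
  have e : g0 1 = √kap * Real.arctan √kap := by
    have hk : 0 < 2 * (√2 - 1) := kap_pos
    have : 0 < √(2 * (√2 - 1) + 1) := Real.sqrt_pos.2 (by linarith)
    unfold g0 kap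
    simp [this.ne']
  -- `√κ` is close to `1`, so `arctan √κ` is `π / 4` minus a small arctangent
  have h := arctan_sub_arctan (x := 1) (y := √kap) (by simp)
  rw [Real.arctan_one, one_mul] at h
  have hp1 := Real.pi_gt_d20
  have hp2 := Real.pi_lt_d20
  rw [e]
  generalize √kap = k at *
  have hy1 : 0.04702189948 < (1 - k) / (1 + k) := by
    rw [lt_div_iff₀ (by linarith)]; linarith
  have hy2 : (1 - k) / (1 + k) < 0.04702189952 := by
    rw [div_lt_iff₀ (by linarith)]; linarith
  generalize (1 - k) / (1 + k) = y at *
  obtain ⟨ha1, ha2⟩ := arctan_bounds (x := y) (by linarith)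
  have h3 : y ^ 3 ≤ 0.04702189952 ^ 3 := pow_le_pow_left₀ (by linarith) hy2.le 3
  have h3' : 0.04702189948 ^ 3 ≤ y ^ 3 := pow_le_pow_left₀ (by linarith) hy1.le 3
  have h5 : y ^ 5 ≤ 0.04702189952 ^ 5 := pow_le_pow_left₀ (by linarith) hy2.le 5
  norm_num at h3 h3' h5 hk1 hk2 hp1 hp2
  constructor <;> nlinarith

theorem g0_neg_one_mem : -0.47425206 < g0 (-1) ∧ g0 (-1) < -0.47425199 := by
  obtain ⟨hk1, hk2⟩ := sqrt_kap_mem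
  obtain ⟨hs1, hs2⟩ := sqrt_two_mem
  obtain ⟨ht1, ht2⟩ := sqrt_three_mem
  have e : g0 (-1) = -(√kap * Real.arctan (√kap / (3 - √2))) := by
    have e1 : 2 * (√2 - 1) * -1 + 1 = (√2 - 1) ^ 2 := by rw [← one_sub_kap, kap]; ring
    have e2 : 2 * (√2 - 1) * √(1 - -1) + (√2 - 1) = 3 - √2 := by
      norm_num
      have := Real.sq_sqrt (show (0 : ℝ) ≤ 2 by norm_num)
      linarith
    rw [g0, e1, Real.sqrt_sq (by linarith), e2, show (1 : ℝ) - -1 = 2 by norm_num,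
      show √2 - 1 - √2 = (-1 : ℝ) by ring, ← kap, mul_neg_one, neg_div, Real.arctan_neg, mul_neg]
  have hx1 : 0.57396109 < √kap / (3 - √2) := by
    rw [lt_div_iff₀ (by linarith)]; linarith
  have hx2 : √kap / (3 - √2) < 0.57396111 := by
    rw [div_lt_iff₀ (by linarith)]; linarith
  -- `√κ / (3 - √2)` is close to `1 / √3`, whose arctangent is `π / 6`
  have h := arctan_sub_arctan (x := (√3)⁻¹) (y := √kap / (3 - √2))
    (mul_nonneg (by positivity) (by linarith))
  rw [Real.arctan_inv_sqrt_three] at h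
  have hp1 := Real.pi_gt_d20
  have hp2 := Real.pi_lt_d20
  have hi1 : 0.57735026918 < (√3)⁻¹ := by
    rw [lt_inv_comm₀ (by norm_num) (by linarith)]; exact lt_trans ht2 (by norm_num)
  have hi2 : (√3)⁻¹ < 0.57735026920 := by
    rw [inv_lt_comm₀ (by linarith) (by norm_num)]; exact lt_trans (by norm_num) ht1
  rw [e]
  generalize √kap / (3 - √2) = x at *
  generalize (√3)⁻¹ = r at *
  generalize √kap = k at *
  have hrx1 : 0.57735026918 * 0.57396109 ≤ r * x := by gcongr
  have hrx2 : r * x ≤ 0.57735026920 * 0.57396111 := by gcongr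
  norm_num at hrx1 hrx2
  have hy1 : 0.002545604 < (r - x) / (1 + r * x) := by
    rw [lt_div_iff₀ (by linarith)]; linarith
  have hy2 : (r - x) / (1 + r * x) < 0.002545632 := by
    rw [div_lt_iff₀ (by linarith)]; linarith
  generalize (r - x) / (1 + r * x) = y at *
  obtain ⟨ha1, ha2⟩ := arctan_bounds (x := y) (by linarith)
  have h3 : y ^ 3 ≤ 0.002545632 ^ 3 := pow_le_pow_left₀ (by linarith) hy2.le 3
  have h3' : 0.002545604 ^ 3 ≤ y ^ 3 := pow_le_pow_left₀ (by linarith) hy1.le 3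
  have h5 : y ^ 5 ≤ 0.002545632 ^ 5 := pow_le_pow_left₀ (by linarith) hy2.le 5
  norm_num at h3 h3' h5 hk1 hk2 hp1 hp2
  constructor <;> nlinarith

theorem Phi_one_eq : Phi 1 = kap * Real.log (1 / 2 * √(kap + 1)) + g0 1 := by
  simp [Phi, kap]

theorem Phi_neg_one_eq : Phi (-1) = kap * Real.log (√2 - 1 / 2) + g0 (-1) := by
  have e : 2 * (√2 - 1) * -1 + 1 = (√2 - 1) ^ 2 := by rw [← one_sub_kap, kap]; ring
  have h2 := sqrt_two_mem
  rw [Phi, e, Real.sqrt_sq (by linarith), kap]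
  norm_num
  left
  congr 1
  ring


theorem Phi_one_mem : 0.34782434 < Phi 1 ∧ Phi 1 < 0.34782443 := by
  have hk := kap_mem
  have hs := sqrt_two_mem
  have e : Real.log (1 / 2 * √(kap + 1)) = (Real.log (√2 - 1 / 2) - Real.log 2) / 2 := by
    have h0 : (0 : ℝ) < kap + 1 := by linarith
    rw [← Real.log_div (by linarith) (by norm_num),
      show (√2 - 1 / 2) / 2 = (1 / 2 * √(kap + 1)) ^ 2 by
        rw [mul_pow, Real.sq_sqrt h0.le, kap]; ring, Real.log_pow]
    push_cast
    ring
  obtain ⟨h1, h2⟩ := g0_one_mem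
  obtain ⟨h3, h4⟩ := log_sqrt_two_sub_half_mem
  have h5 := Real.log_two_gt_d9
  have h6 := Real.log_two_lt_d9
  rw [Phi_one_eq, e]
  constructor <;> nlinarith

theorem Phi_neg_one_mem : -0.5485547 < Phi (-1) ∧ Phi (-1) < -0.5485544 := by
  have hk := kap_mem
  obtain ⟨h1, h2⟩ := g0_neg_one_mem
  obtain ⟨h3, h4⟩ := log_sqrt_two_sub_half_mem
  rw [Phi_neg_one_eq]
  constructor <;> nlinarith

theorem log_five_thirds_mem :
    0.5108256235 < Real.log (5 / 3) ∧ Real.log (5 / 3) < 0.5108256242 := by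
  rw [Real.log_div (by norm_num) (by norm_num)]
  have := Real.log_five_gt_d9
  have := Real.log_five_lt_d9
  have := Real.log_three_gt_d9
  have := Real.log_three_lt_d9
  constructor <;> linarith

theorem betaA_eq : betaA = -(3 * Phi (-1) / 2) := by
  have e : 2 * (√2 - 1) * -1 + 1 = 1 - 2 * (√2 - 1) := by ring
  rw [betaA, Phi, e]
  norm_num

theorem betaB_eq : betaB = Phi 1 / Real.log (5 / 3) := by
  simp [betaB, Phi]

theorem betaC_eq : betaC = 5 * Phi 1 / 2 := by
  simp [betaC, Phi]

theorem abs_betaA_sub_lt : |betaA - 0.822832| < 0.0000005 := by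
  have := Phi_neg_one_mem
  rw [betaA_eq, abs_lt]
  constructor <;> linarith

theorem abs_betaB_sub_lt : |betaB - 0.680906| < 0.0000005 := by
  have h1 := Phi_one_mem
  have h2 := log_five_thirds_mem
  have h3 : 0 < Real.log (5 / 3) := by linarith
  have h4 : 0.680906 - 0.0000005 < Phi 1 / Real.log (5 / 3) := by
    rw [lt_div_iff₀ h3]; linarith
  have h5 : Phi 1 / Real.log (5 / 3) < 0.680906 + 0.0000005 := by
    rw [div_lt_iff₀ h3]; linarith
  rw [betaB_eq, abs_lt]
  constructor <;> linarith

theorem abs_betaC_sub_lt : |betaC - 0.869561| < 0.0000005 := by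
  have := Phi_one_mem
  rw [betaC_eq, abs_lt]
  constructor <;> linarith

/-! ### Estimates for the lemniscate map -/

theorem phiRL_eq (z : ℂ) :
    phiRL z = 1 + ((√2 : ℝ) - 1) * (1 - ((1 - z) / (1 + kap * z)) ^ (1 / 2 : ℂ)) := by
  simp only [phiRL, kap]
  push_cast
  ring

theorem one_add_kap_mul_ne_zero {z : ℂ} (hz : ‖z‖ < 1) : 1 + kap * z ≠ 0 := by
  intro h
  have h1 : (kap : ℂ) * z = -1 := by linear_combination h
  have h2 := congrArg norm h1
  rw [norm_mul, Complex.norm_real, Real.norm_of_nonneg kap_pos.le, norm_neg, norm_one] at h2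
  nlinarith [kap_pos, kap_lt_one, norm_nonneg z]

theorem moebius_re_pos {z : ℂ} (hz : ‖z‖ < 1) : 0 < ((1 - z) / (1 + kap * z)).re := by
  have h0 := one_add_kap_mul_ne_zero hz
  have hN := Complex.normSq_pos.2 h0
  have h1 : ((1 - z) / (1 + kap * z)).re =
      (1 - (1 - kap) * z.re - kap * (z.re ^ 2 + z.im ^ 2)) / Complex.normSq (1 + kap * z) := by
    rw [Complex.div_re, ← add_div]
    congr 1
    simp
    ring
  rw [h1]
  apply div_pos _ hN
  have h2 : z.re ^ 2 + z.im ^ 2 < 1 := by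
    have : ‖z‖ ^ 2 = z.re ^ 2 + z.im ^ 2 := by rw [Complex.sq_norm, Complex.normSq_apply]; ring
    rw [← this]; nlinarith [norm_nonneg z]
  have h3 : z.re < 1 := lt_of_le_of_lt (Complex.re_le_norm z) hz
  nlinarith [kap_pos, kap_lt_one]

theorem differentiableOn_phiRL : DifferentiableOn ℂ phiRL disk := by
  intro z hz
  have hz : ‖z‖ < 1 := by simpa [disk] using hz
  have : DifferentiableAt ℂ (fun z : ℂ =>
      1 + ((√2 : ℝ) - 1) * (1 - ((1 - z) / (1 + kap * z)) ^ (1 / 2 : ℂ))) z := by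
    refine (DifferentiableAt.const_mul (DifferentiableAt.const_sub ?_ _) _).const_add _
    refine DifferentiableAt.cpow ?_ (by fun_prop) (Or.inl (moebius_re_pos hz))
    exact DifferentiableAt.div (by fun_prop) (by fun_prop) (one_add_kap_mul_ne_zero hz)
  rw [show phiRL = _ from funext phiRL_eq]
  exact this.differentiableWithinAt

theorem cpow_half_re_pos {m : ℂ} (hm : 0 < m.re) : 0 < (m ^ (1 / 2 : ℂ)).re := by
  have hm0 : m ≠ 0 := by rintro rfl; simp at hm
  have ha : |m.arg| < π / 2 := Complex.abs_arg_lt_pi_div_two_iff.2 (Or.inl hm)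
  rw [abs_lt] at ha
  rw [Complex.cpow_def_of_ne_zero hm0, Complex.exp_re]
  refine mul_pos (Real.exp_pos _) (Real.cos_pos_of_mem_Ioo ?_)
  have : (Complex.log m * (1 / 2)).im = m.arg / 2 := by
    rw [show Complex.log m * (1 / 2) = Complex.log m / (2 : ℝ) by push_cast; ring,
      Complex.div_ofReal_im, Complex.log_im]
  rw [this]
  constructor <;> linarith [Real.pi_pos]

theorem cpow_half_sq (m : ℂ) : (m ^ (1 / 2 : ℂ)) ^ 2 = m := by
  rw [one_div]
  exact Complex.cpow_ofNat_inv_pow m 2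

/-- If `s = σ + iτ` satisfies `s² = (1 - w) / (1 + c w)` with `|w| ≤ t`, then `s²` lies in a disk;
this is that disk's equation in terms of `σ` and `τ`. -/
theorem root_disk_ineq {s w : ℂ} {t c : ℝ} (hw : ‖w‖ ≤ t) (h : s ^ 2 * (1 + c * w) = 1 - w) :
    (1 - c ^ 2 * t ^ 2) * (s.re ^ 2 + s.im ^ 2) ^ 2 + (1 - t ^ 2) ≤
      2 * (1 + c * t ^ 2) * (s.re ^ 2 - s.im ^ 2) := by
  have h1 : 1 - s ^ 2 = w * (1 + c * s ^ 2) := by linear_combination -h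
  have h2 := congrArg (fun x => ‖x‖ ^ 2) h1
  simp only [norm_mul, mul_pow] at h2
  have h3 : ‖1 - s ^ 2‖ ^ 2 =
      1 - 2 * (s.re ^ 2 - s.im ^ 2) + (s.re ^ 2 + s.im ^ 2) ^ 2 := by
    rw [Complex.sq_norm, Complex.normSq_apply]
    simp [sq]
    ring
  have h4 : ‖1 + c * s ^ 2‖ ^ 2 =
      1 + 2 * c * (s.re ^ 2 - s.im ^ 2) + c ^ 2 * (s.re ^ 2 + s.im ^ 2) ^ 2 := by
    rw [Complex.sq_norm, Complex.normSq_apply]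
    simp [sq]
    ring
  have h5 : ‖w‖ ^ 2 ≤ t ^ 2 := pow_le_pow_left₀ (norm_nonneg w) hw 2
  have h6 : ‖1 - s ^ 2‖ ^ 2 ≤ t ^ 2 * ‖1 + c * s ^ 2‖ ^ 2 := by
    rw [h2]; gcongr
  rw [h3, h4] at h6
  linarith

/-- The data of a value `φ_RL(w) - 1` in terms of the square root `s` in the definition. -/
theorem exists_root {w : ℂ} {t : ℝ} (hw : ‖w‖ ≤ t) (ht : t < 1) :
    ∃ s : ℂ, 0 < s.re ∧ (phiRL w - 1).re = (√2 - 1) * (1 - s.re) ∧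
      (phiRL w - 1).im = -((√2 - 1) * s.im) ∧
      (1 - kap ^ 2 * t ^ 2) * (s.re ^ 2 + s.im ^ 2) ^ 2 + (1 - t ^ 2) ≤
        2 * (1 + kap * t ^ 2) * (s.re ^ 2 - s.im ^ 2) := by
  have hw1 : ‖w‖ < 1 := hw.trans_lt ht
  have e : phiRL w - 1 = ((√2 - 1 : ℝ) : ℂ) * (1 - ((1 - w) / (1 + kap * w)) ^ (1 / 2 : ℂ)) := by
    rw [phiRL_eq]; push_cast; ring
  refine ⟨((1 - w) / (1 + kap * w)) ^ (1 / 2 : ℂ), cpow_half_re_pos (moebius_re_pos hw1), ?_, ?_,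
    root_disk_ineq hw ?_⟩
  · rw [e, Complex.re_ofReal_mul]; simp
  · rw [e, Complex.im_ofReal_mul]; simp
  · rw [cpow_half_sq, div_mul_cancel₀ _ (one_add_kap_mul_ne_zero hw1)]

/-- On the disk `|w| ≤ t` the real part of `φ_RL - 1` is extremal at `±t`. -/
theorem phiRL_re_mem {w : ℂ} {t : ℝ} (hw : ‖w‖ ≤ t) (ht : t < 1) :
    lemR (-t) ≤ (phiRL w - 1).re ∧ (phiRL w - 1).re ≤ lemR t := by
  obtain ⟨s, hs, hre, -, hq⟩ := exists_root hw ht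
  have ht0 : 0 ≤ t := (norm_nonneg w).trans hw
  have hk := kap_pos
  have hk1 := kap_lt_one
  have hkt : kap * t < 1 := by nlinarith
  have hkt0 : 0 ≤ kap * t := by positivity
  -- dropping the imaginary part leaves a quadratic inequality for `σ²` with roots `m(t)`, `m(-t)`
  have h2 : ((1 + kap * t) * s.re ^ 2 - (1 - t)) * ((1 - kap * t) * s.re ^ 2 - (1 + t)) ≤ 0 := by
    have h3 : s.re ^ 4 ≤ (s.re ^ 2 + s.im ^ 2) ^ 2 := by
      nlinarith [mul_nonneg (sq_nonneg s.re) (sq_nonneg s.im), sq_nonneg (s.im ^ 2)]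
    have h4 : 0 ≤ 1 - kap ^ 2 * t ^ 2 := by nlinarith
    have h5 := mul_le_mul_of_nonneg_left h3 h4
    nlinarith [mul_nonneg (show 0 ≤ 2 * (1 + kap * t ^ 2) by positivity) (sq_nonneg s.im)]
  have h2s : (1 : ℝ) ≤ √2 := by linarith [sqrt_two_mem.1]
  have hlow : (1 - t) / (1 + kap * t) ≤ s.re ^ 2 := by
    rw [div_le_iff₀ (by linarith)]
    by_contra! hc
    have : (1 - kap * t) * s.re ^ 2 - (1 + t) < 0 := by nlinarith [sq_nonneg s.re]
    nlinarith
  have hup : s.re ^ 2 ≤ (1 + t) / (1 - kap * t) := by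
    rw [le_div_iff₀ (by linarith)]
    by_contra! hc
    have : 0 < (1 + kap * t) * s.re ^ 2 - (1 - t) := by nlinarith [sq_nonneg s.re]
    nlinarith
  have hs1 : √((1 - t) / (1 + kap * t)) ≤ s.re := (Real.sqrt_le_left hs.le).2 hlow
  have hs2 : s.re ≤ √((1 + t) / (1 - kap * t)) := Real.le_sqrt_of_sq_le hup
  rw [hre]
  constructor
  · rw [lemR, show (1 - -t) / (1 + 2 * (√2 - 1) * -t) = (1 + t) / (1 - kap * t) by
      unfold kap; congr 1 <;> ring]
    exact mul_le_mul_of_nonneg_left (by linarith) (by linarith)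
  · rw [lemR, ← kap]
    exact mul_le_mul_of_nonneg_left (by linarith) (by linarith)

/-- At `u = 1` and with `0.5` in place of `0.385 + 0.125 u` this is an equality. -/
theorem kap_quartic_ineq {u : ℝ} (hu0 : 0 ≤ u) (hu : u ≤ 1) :
    kap ^ 2 * (1 + kap) ^ 2 ≤
      16 * ((1 + kap * u) * (1 - kap ^ 2 * u)) * (0.385 + 0.125 * u) ^ 2 := by
  obtain ⟨hk1, hk2⟩ := kap_mem
  have e1 : kap ^ 2 * (1 + kap) ^ 2 ≤ 16 * 0.1434 := by
    rw [← mul_pow]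
    have h1 : kap * (1 + kap) ≤ 1.51472 := by nlinarith
    have h0 : 0 ≤ kap * (1 + kap) := by nlinarith
    exact (pow_le_pow_left₀ h0 h1 2).trans (by norm_num)
  have e2 : 1 + 0.142 * u - 0.5687 * u ^ 2 ≤ (1 + kap * u) * (1 - kap ^ 2 * u) := by
    have h3 : kap ^ 3 ≤ 0.5687 :=
      (pow_le_pow_left₀ kap_pos.le hk2.le 3).trans (by norm_num)
    have h4 : 0.142 ≤ kap - kap ^ 2 := by nlinarith
    linarith [mul_le_mul_of_nonneg_right h3 (sq_nonneg u), mul_le_mul_of_nonneg_right h4 hu0]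
  have e3 := mul_le_mul_of_nonneg_right e2 (sq_nonneg (0.385 + 0.125 * u))
  have e4 : u ^ 2 ≤ u := pow_le_of_le_one hu0 hu (by norm_num)
  have e5 : u ^ 3 ≤ u := pow_le_of_le_one hu0 hu (by norm_num)
  have e6 : u ^ 4 ≤ u := pow_le_of_le_one hu0 hu (by norm_num)
  linarith

/-- A bound for `Im φ_RL` on the disk `|w| ≤ t`, close to the sharp one both for small `t` and at
`t = 1`, where the sharp bound is `1/2`. -/
theorem abs_phiRL_im_le {w : ℂ} {t : ℝ} (hw : ‖w‖ ≤ t) (ht : t < 1) :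
    |(phiRL w - 1).im| ≤ t * (0.385 + 0.125 * t ^ 2) := by
  obtain ⟨s, hs, -, him, hq⟩ := exists_root hw ht
  have ht0 : 0 ≤ t := (norm_nonneg w).trans hw
  obtain ⟨hk1, hk2⟩ := kap_mem
  have hh : √2 - 1 = kap / 2 := by unfold kap; ring
  rw [him, abs_neg, hh]
  have hb : 0 ≤ t * (0.385 + 0.125 * t ^ 2) := by positivity
  refine abs_le_of_sq_le_sq ?_ hb
  have hk0 : kap ^ 2 ≤ 0.6863 := by nlinarith
  have hu : t ^ 2 ≤ 1 := by nlinarith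
  have hu0 : 0 ≤ t ^ 2 := sq_nonneg t
  have hA : 0 < 1 - kap ^ 2 * t ^ 2 := by nlinarith
  have hB : 0 < 1 + kap * t ^ 2 := by nlinarith
  -- completing the square in `|s|²`
  have h1 : 4 * (1 + kap * t ^ 2) * (1 - kap ^ 2 * t ^ 2) * s.im ^ 2 ≤ t ^ 2 * (1 + kap) ^ 2 := by
    have h2 := mul_le_mul_of_nonneg_left hq hA.le
    nlinarith [sq_nonneg ((1 - kap ^ 2 * t ^ 2) * (s.re ^ 2 + s.im ^ 2) - (1 + kap * t ^ 2))]
  have hD := kap_quartic_ineq hu0 hu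
  have hAB := mul_pos hB hA
  rw [← mul_le_mul_iff_right₀ (mul_pos (by norm_num : (0 : ℝ) < 16) hAB)]
  calc 16 * ((1 + kap * t ^ 2) * (1 - kap ^ 2 * t ^ 2)) * (kap / 2 * s.im) ^ 2
      = kap ^ 2 * (4 * (1 + kap * t ^ 2) * (1 - kap ^ 2 * t ^ 2) * s.im ^ 2) := by ring
    _ ≤ kap ^ 2 * (t ^ 2 * (1 + kap) ^ 2) := by gcongr
    _ = t ^ 2 * (kap ^ 2 * (1 + kap) ^ 2) := by ring
    _ ≤ t ^ 2 * (16 * ((1 + kap * t ^ 2) * (1 - kap ^ 2 * t ^ 2)) *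
        (0.385 + 0.125 * t ^ 2) ^ 2) := by gcongr
    _ = _ := by ring

theorem phiRL_ofReal {x : ℝ} (hx : -1 < x) (hx' : x < 1) : phiRL x = ((1 + lemR x : ℝ) : ℂ) := by
  have h0 := one_add_kap_mul_pos hx.le
  have h1 : 0 ≤ (1 - x) / (1 + kap * x) := div_nonneg (by linarith) (by linarith)
  rw [phiRL_eq, lemR, ← kap, Real.sqrt_eq_rpow ((1 - x) / _), Complex.ofReal_add,
    Complex.ofReal_mul, Complex.ofReal_sub 1, Complex.ofReal_cpow h1]
  push_cast
  rfl

@[simp] theorem phiRL_zero : phiRL 0 = 1 := by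
  simp [phiRL_eq]

/-! ### Subordination to the nephroid map -/

theorem mem_disk {z : ℂ} : z ∈ disk ↔ ‖z‖ < 1 := by simp [disk]

theorem zero_mem_disk : (0 : ℂ) ∈ disk := by simp [disk]

theorem isOpen_disk : IsOpen disk := Metric.isOpen_ball

theorem hasStrictDerivAt_phiNe (z : ℂ) : HasStrictDerivAt phiNe (1 - z ^ 2) z := by
  have := ((hasStrictDerivAt_id z).const_add 1).sub
    ((hasStrictDerivAt_pow 3 z).mul_const (1 / 3 : ℂ))
  convert! this using 1
  · ext z; simp [phiNe]; ring
  · norm_num; ring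

theorem differentiable_phiNe : Differentiable ℂ phiNe := fun z =>
  (hasStrictDerivAt_phiNe z).hasDerivAt.differentiableAt

theorem phiNe_sub_phiNe (z u : ℂ) :
    phiNe z - phiNe u = (z - u) * (1 - (z ^ 2 + z * u + u ^ 2) / 3) := by
  unfold phiNe; ring

theorem phiNe_factor_ne_zero {z u : ℂ} (hz : ‖z‖ < 1) (hu : ‖u‖ ≤ 1) :
    1 - (z ^ 2 + z * u + u ^ 2) / 3 ≠ 0 := by
  intro h
  have h1 : z ^ 2 + z * u + u ^ 2 = 3 := by linear_combination -3 * h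
  have h2 : ‖z ^ 2 + z * u + u ^ 2‖ ≤ ‖z‖ ^ 2 + ‖z‖ * ‖u‖ + ‖u‖ ^ 2 := by
    refine (norm_add₃_le).trans ?_
    simp
  rw [h1] at h2
  norm_num at h2
  nlinarith [norm_nonneg z, norm_nonneg u]

/-- A boundary value of `φ_Ne` is not a value on the disk. -/
theorem phiNe_ne_of_norm_le {z u : ℂ} (hz : ‖z‖ < 1) (hu : ‖u‖ ≤ 1) (hne : z ≠ u) :
    phiNe z ≠ phiNe u := by
  rw [← sub_ne_zero, phiNe_sub_phiNe]
  exact mul_ne_zero (sub_ne_zero.2 hne) (phiNe_factor_ne_zero hz hu)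

theorem injOn_phiNe : InjOn phiNe disk := fun z hz u hu h => by
  by_contra hne
  exact phiNe_ne_of_norm_le (mem_disk.1 hz) (mem_disk.1 hu).le hne h

theorem one_sub_sq_ne_zero {z : ℂ} (hz : ‖z‖ < 1) : 1 - z ^ 2 ≠ 0 := by
  have := phiNe_factor_ne_zero hz hz.le
  contrapose! this
  linear_combination this

theorem isOpen_phiNe_image : IsOpen (phiNe '' disk) := by
  rw [isOpen_iff_mem_nhds]
  rintro _ ⟨z, hz, rfl⟩
  rw [← (hasStrictDerivAt_phiNe z).map_nhds_eq (one_sub_sq_ne_zero (mem_disk.1 hz))]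
  exact image_mem_map (isOpen_disk.mem_nhds hz)

/-- An open rectangle in the image of `φ_Ne`. The cusps `1/3` and `5/3` of the nephroid point
inwards, and the vertical sides of the rectangle pass through them. -/
def rect : Set ℂ := {w | |w.re - 1| < 2 / 3 ∧ |w.im| < 1.06}

theorem convex_rect : Convex ℝ rect := by
  have : rect = Complex.re ⁻¹' Ioo (1 / 3) (5 / 3) ∩ Complex.im ⁻¹' Ioo (-1.06) 1.06 := by
    ext w
    simp only [rect, mem_ofPred_eq, abs_lt, mem_inter_iff, mem_preimage, mem_Ioo]
    refine and_congr (and_congr ?_ ?_) Iff.rfl <;> constructor <;> intro h <;> linarith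
  rw [this]
  exact ((convex_Ioo _ _).linear_preimage Complex.reLm).inter
    ((convex_Ioo _ _).linear_preimage Complex.imLm)

theorem phiNe_notMem_rect {z : ℂ} (hz : ‖z‖ = 1) : phiNe z ∉ rect := by
  rintro ⟨h1, h2⟩
  have hn : z.re ^ 2 + z.im ^ 2 = 1 := by
    have := congrArg (· ^ 2) hz
    simp only [Complex.sq_norm, Complex.normSq_apply] at this
    linarith
  have hre : (phiNe z).re - 1 = 2 * z.re * (1 - 2 / 3 * z.re ^ 2) := by
    simp [phiNe, pow_succ]
    linear_combination z.re * hn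
  have him : (phiNe z).im = 4 / 3 * z.im ^ 3 := by
    simp [phiNe, pow_succ]
    linear_combination -z.im * hn
  rw [hre] at h1
  rw [him] at h2
  have h1 := sq_lt_sq' (abs_lt.1 h1).1 (abs_lt.1 h1).2
  have h2 := sq_lt_sq' (abs_lt.1 h2).1 (abs_lt.1 h2).2
  -- with `y = (Re z)²` the two inequalities read `y < 1 - √3/2` and `y > 0.14`
  have hs : z.im ^ 2 = 1 - z.re ^ 2 := by linarith
  have e1 : (2 * z.re * (1 - 2 / 3 * z.re ^ 2)) ^ 2 - (2 / 3) ^ 2 =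
      4 / 9 * ((z.re ^ 2 - 1) * (4 * (z.re ^ 2) ^ 2 - 8 * z.re ^ 2 + 1)) := by ring
  have e2 : (4 / 3 * z.im ^ 3) ^ 2 = 16 / 9 * (1 - z.re ^ 2) ^ 3 := by rw [← hs]; ring
  have hy1 : z.re ^ 2 ≤ 1 := by nlinarith
  have hy0 : 0 ≤ z.re ^ 2 := sq_nonneg _
  rw [e2] at h2
  have h3 : (z.re ^ 2 - 1) * (4 * (z.re ^ 2) ^ 2 - 8 * z.re ^ 2 + 1) < 0 := by linarith
  generalize z.re ^ 2 = y at *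
  have h4 : 0.14 < y := by
    by_contra! hc
    have : (0.86 : ℝ) ^ 3 ≤ (1 - y) ^ 3 := pow_le_pow_left₀ (by norm_num) (by linarith) 3
    norm_num at this h2
    linarith
  nlinarith [mul_nonneg (sub_nonneg.2 hy1) (sub_nonneg.2 h4.le)]

theorem rect_subset_phiNe_image : rect ⊆ phiNe '' disk := by
  have h0 : phiNe 0 = 1 := by simp [phiNe]
  -- the image is open, and closed relative to the rectangle because no boundary value lies in it
  refine convex_rect.isPreconnected.subset_of_closure_inter_subset isOpen_phiNe_image
    ⟨1, by norm_num [rect], 0, zero_mem_disk, h0⟩ ?_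
  rintro w ⟨hw, hwr⟩
  have hc : IsClosed (phiNe '' Metric.closedBall 0 1) :=
    ((isCompact_closedBall (0 : ℂ) 1).image differentiable_phiNe.continuous).isClosed
  obtain ⟨z, hz, rfl⟩ := closure_minimal (image_mono Metric.ball_subset_closedBall) hc hw
  refine ⟨z, ?_, rfl⟩
  rw [mem_disk]
  refine lt_of_le_of_ne (by simpa using hz) fun h => phiNe_notMem_rect h hwr

theorem differentiableAt_phiNe_inverse {u : ℂ} (hu : u ∈ disk) :
    DifferentiableAt ℂ (Function.invFunOn phiNe disk) (phiNe u) := by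
  have hd := hasStrictDerivAt_phiNe u
  have hne := one_sub_sq_ne_zero (mem_disk.1 hu)
  have hd' := hd.hasStrictFDerivAt_equiv hne
  have hl := (hd.to_localInverse hne).hasDerivAt.differentiableAt
  refine hl.congr_of_eventuallyEq ?_
  have h1 := hd'.eventually_right_inverse
  have h2 := hd'.localInverse_tendsto.eventually (isOpen_disk.mem_nhds hu)
  filter_upwards [h1, h2] with y hy1 hy2
  have hmem : y ∈ phiNe '' disk := ⟨_, hy2, hy1⟩
  exact injOn_phiNe (Function.invFunOn_mem hmem) hy2 ((Function.invFunOn_eq hmem).trans hy1.symm)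

theorem subordinate_phiNe_of_mapsTo {p : ℂ → ℂ} (hp : DifferentiableOn ℂ p disk) (hp0 : p 0 = 1)
    (h : MapsTo p disk rect) : Subordinate p phiNe := by
  have h0 : phiNe 0 = 1 := by simp [phiNe]
  refine ⟨hp, differentiable_phiNe.differentiableOn, Function.invFunOn phiNe disk ∘ p,
    fun z hz => ?_, ?_, fun z hz => ?_, fun z hz => ?_⟩
  · obtain ⟨u, hu, he⟩ := rect_subset_phiNe_image (h hz)
    have := differentiableAt_phiNe_inverse hu
    rw [he] at this
    exact this.comp_differentiableWithinAt z (hp z hz)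
  · rw [Function.comp_apply, hp0, ← h0]
    exact injOn_phiNe.leftInvOn_invFunOn zero_mem_disk
  · exact mem_disk.1 (Function.invFunOn_mem (rect_subset_phiNe_image (h hz)))
  · exact (Function.invFunOn_eq (rect_subset_phiNe_image (h hz))).symm

/-- A function taking the value of a cusp of the nephroid is not subordinate to `φ_Ne`. -/
theorem not_subordinate_phiNe {p : ℂ → ℂ} {z : ℂ} (hz : z ∈ disk) (h : p z = 5 / 3 ∨ p z = 1 / 3) :
    ¬ Subordinate p phiNe := by
  rintro ⟨-, -, w, -, -, hw, he⟩
  have hne : ∀ u : ℂ, ‖u‖ = 1 → p z ≠ phiNe u := fun u hu hpu => by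
    refine phiNe_ne_of_norm_le (hw z hz) hu.le ?_ ((he z hz).symm.trans hpu)
    rintro rfl
    exact (hw z hz).ne hu
  rcases h with h | h
  · exact hne 1 (by simp) (by rw [h]; norm_num [phiNe])
  · exact hne (-1) (by simp) (by rw [h]; norm_num [phiNe])

/-! ### Comparison along radii -/

/-- Comparison of derivatives on the open unit interval; the derivatives may be singular at `0`. -/
theorem le_of_hasDerivAt_le {F G F' G' : ℝ → ℝ} (hF : ContinuousOn F (Icc 0 1))
    (hG : ContinuousOn G (Icc 0 1)) (hF' : ∀ t ∈ Ioo (0 : ℝ) 1, HasDerivAt F (F' t) t)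
    (hG' : ∀ t ∈ Ioo (0 : ℝ) 1, HasDerivAt G (G' t) t) (h : ∀ t ∈ Ioo (0 : ℝ) 1, F' t ≤ G' t)
    (h0 : F 0 = G 0) : F 1 ≤ G 1 := by
  have hm : MonotoneOn (fun t => G t - F t) (Icc 0 1) := by
    refine monotoneOn_of_hasDerivWithinAt_nonneg (f' := fun t => G' t - F' t) (convex_Icc _ _)
      (hG.sub hF) (fun t ht => ?_) fun t ht => ?_
    · rw [interior_Icc] at ht
      exact ((hG' t ht).sub (hF' t ht)).hasDerivWithinAt
    · rw [interior_Icc] at ht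
      exact sub_nonneg.2 (h t ht)
  have := hm (left_mem_Icc.2 zero_le_one) (right_mem_Icc.2 zero_le_one) zero_le_one
  simp only [h0, sub_self] at this
  linarith

theorem mul_mem_disk {z : ℂ} (hz : z ∈ disk) {t : ℝ} (ht : t ∈ Icc (0 : ℝ) 1) :
    (t : ℂ) * z ∈ disk := by
  rw [mem_disk] at *
  rw [norm_mul, Complex.norm_real, Real.norm_of_nonneg ht.1]
  nlinarith [ht.1, ht.2, norm_nonneg z]

/-- If `z P'(z)` has values in `φ_RL - 1` with `|w(z)| ≤ |z|`, then its real part along a radius is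
dominated by its values on the real axis, and integration gives sharp bounds for `Re P`. -/
theorem bounds_of_mul_deriv_eq {P w : ℂ → ℂ} (hP : DifferentiableOn ℂ P disk) (hP0 : P 0 = 0)
    (hw : ∀ z ∈ disk, ‖w z‖ ≤ ‖z‖) (hPw : ∀ z ∈ disk, z * deriv P z = phiRL (w z) - 1)
    {z : ℂ} (hz : z ∈ disk) :
    Phi (-‖z‖) ≤ (P z).re ∧ (P z).re ≤ Phi ‖z‖ ∧ |(P z).im| ≤ 0.427 := by
  have hz1 := mem_disk.1 hz
  have hz0 := norm_nonneg z
  set r := ‖z‖ with hr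
  have hd : ∀ t ∈ Icc (0 : ℝ) 1,
      HasDerivAt (fun ζ : ℂ => P (ζ * z)) (z * deriv P (t * z)) t := fun t ht => by
    have h1 := (hP.differentiableAt (isOpen_disk.mem_nhds (mul_mem_disk hz ht))).hasDerivAt
    have h2 := HasDerivAt.comp (t : ℂ) h1 ((hasDerivAt_id (t : ℂ)).mul_const z)
    refine h2.congr_deriv ?_
    ring
  have hre : ∀ t ∈ Icc (0 : ℝ) 1, HasDerivAt (fun t : ℝ => (P (t * z)).re)
      (z * deriv P (t * z)).re t := fun t ht => (hd t ht).real_of_complex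
  have him : ∀ t ∈ Icc (0 : ℝ) 1, HasDerivAt (fun t : ℝ => (P (t * z)).im)
      (z * deriv P (t * z)).im t := fun t ht => by
    -- `Im x = Re (-i x)`
    simpa using ((hd t ht).const_mul (-Complex.I)).real_of_complex
  have hreC : ContinuousOn (fun t : ℝ => (P (t * z)).re) (Icc 0 1) := fun t ht =>
    (hre t ht).continuousAt.continuousWithinAt
  have himC : ContinuousOn (fun t : ℝ => (P (t * z)).im) (Icc 0 1) := fun t ht =>
    (him t ht).continuousAt.continuousWithinAt
  have hv : ∀ t ∈ Ioo (0 : ℝ) 1, ((t : ℂ) * (z * deriv P (t * z)) = phiRL (w (t * z)) - 1) ∧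
      ‖w (t * z)‖ ≤ t * r ∧ t * r < 1 := fun t ht => by
    have hm := mul_mem_disk hz (Ioo_subset_Icc_self ht)
    have hn : ‖(t : ℂ) * z‖ = t * r := by
      rw [norm_mul, Complex.norm_real, Real.norm_of_nonneg ht.1.le]
    refine ⟨by rw [← hPw _ hm]; ring, hn ▸ hw _ hm, by nlinarith [ht.1, ht.2]⟩
  have hPhi : ∀ σ : ℝ, (σ = 1 ∨ σ = -1) → ContinuousOn (fun t => Phi (σ * r * t)) (Icc 0 1) ∧
      ∀ t ∈ Ioo (0 : ℝ) 1, HasDerivAt (fun t => Phi (σ * r * t)) (lemR (σ * r * t) / t) t := by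
    intro σ hσ
    have hb : ∀ t ∈ Icc (0 : ℝ) 1, -1 < σ * r * t ∧ σ * r * t < 1 := fun t ht => by
      have : r * t < 1 := by nlinarith [ht.1, ht.2]
      have : 0 ≤ r * t := mul_nonneg hz0 ht.1
      rcases hσ with rfl | rfl <;> constructor <;> linarith
    constructor
    · exact Phi_continuousOn.comp (by fun_prop) fun t ht => ⟨(hb t ht).1.le, (hb t ht).2.le⟩
    · intro t ht
      obtain ⟨h1, h2⟩ := hb t (Ioo_subset_Icc_self ht)
      have h3 := (Phi_hasDerivAt h1 h2).comp t ((hasDerivAt_id t).const_mul (σ * r))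
      refine h3.congr_deriv ?_
      rw [← Phi_deriv_mul h1 h2]
      have := ht.1.ne'
      field_simp
  have hscale : ∀ t ∈ Ioo (0 : ℝ) 1, (z * deriv P (t * z)).re = (phiRL (w (t * z)) - 1).re / t ∧
      (z * deriv P (t * z)).im = (phiRL (w (t * z)) - 1).im / t := fun t ht => by
    rw [← (hv t ht).1, Complex.re_ofReal_mul, Complex.im_ofReal_mul]
    have := ht.1.ne'
    constructor <;> field_simp
  have hpoly : ∀ t : ℝ, HasDerivAt (fun t : ℝ => 0.385 * t + 0.125 / 3 * t ^ 3)
      (0.385 + 0.125 * t ^ 2) t := fun t => by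
    have := ((hasDerivAt_id t).const_mul 0.385).add ((hasDerivAt_pow 3 t).const_mul (0.125 / 3))
    refine this.congr_deriv ?_
    norm_num
    ring
  have hpolyC : ContinuousOn (fun t : ℝ => 0.385 * t + 0.125 / 3 * t ^ 3) (Icc 0 1) := by fun_prop
  have himb : ∀ t ∈ Ioo (0 : ℝ) 1, |(z * deriv P (t * z)).im| ≤ 0.385 + 0.125 * t ^ 2 := by
    intro t ht
    obtain ⟨-, h1, h2⟩ := hv t ht
    have h3 := abs_phiRL_im_le h1 h2
    have h4 : t * r ≤ t := by nlinarith [ht.1]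
    have h5 : 0 ≤ t * r := mul_nonneg ht.1.le hz0
    rw [(hscale t ht).2, abs_div, abs_of_pos ht.1, div_le_iff₀ ht.1, mul_comm _ t]
    refine h3.trans ?_
    gcongr
    exact ht.1.le
  refine ⟨?_, ?_, ?_⟩
  · obtain ⟨hc, hdv⟩ := hPhi (-1) (Or.inr rfl)
    have := le_of_hasDerivAt_le hc hreC hdv (fun t ht => hre t (Ioo_subset_Icc_self ht))
      (fun t ht => ?_) (by simp [hP0])
    · simpa using this
    · obtain ⟨-, h1, h2⟩ := hv t ht
      rw [(hscale t ht).1]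
      have := (phiRL_re_mem h1 h2).1
      rw [show -1 * r * t = -(t * r) by ring]
      gcongr
      exact ht.1.le
  · obtain ⟨hc, hdv⟩ := hPhi 1 (Or.inl rfl)
    have := le_of_hasDerivAt_le hreC hc (fun t ht => hre t (Ioo_subset_Icc_self ht)) hdv
      (fun t ht => ?_) (by simp [hP0])
    · simpa using this
    · obtain ⟨-, h1, h2⟩ := hv t ht
      rw [(hscale t ht).1]
      have := (phiRL_re_mem h1 h2).2
      rw [show 1 * r * t = t * r by ring]
      gcongr
      exact ht.1.le
  · have h1 := le_of_hasDerivAt_le himC hpolyC (fun t ht => him t (Ioo_subset_Icc_self ht))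
      (fun t _ => hpoly t) (fun t ht => (abs_le.1 (himb t ht)).2) (by simp [hP0])
    have h2 := le_of_hasDerivAt_le hpolyC.neg himC (fun t _ => (hpoly t).neg)
      (fun t ht => him t (Ioo_subset_Icc_self ht)) (fun t ht => (abs_le.1 (himb t ht)).1)
      (by simp [hP0])
    norm_num at h1 h2
    rw [abs_le]
    constructor <;> linarith

/-! ### The three differential subordinations -/

theorem Subordinate.congr {f f' g : ℂ → ℂ} (h : Subordinate f g) (he : EqOn f' f disk) :
    Subordinate f' g := by
  obtain ⟨h1, h2, w, h3, h4, h5, h6⟩ := h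
  exact ⟨h1.congr he, h2, w, h3, h4, h5, fun z hz => (he hz).trans (h6 z hz)⟩

/-- The bounds are strict since `Phi` is strictly increasing and `|z| < 1`. -/
theorem bounds_of_subordinate {P : ℂ → ℂ} {β : ℝ} (hP : DifferentiableOn ℂ P disk) (hP0 : P 0 = 0)
    (h : Subordinate (fun z => 1 + (β : ℂ) * (z * deriv P z)) phiRL) {z : ℂ} (hz : z ∈ disk) :
    Phi (-1) < β * (P z).re ∧ β * (P z).re < Phi 1 ∧ |β * (P z).im| ≤ 0.427 := by
  obtain ⟨-, -, w, hw, hw0, hw1, he⟩ := h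
  have hs : ∀ z ∈ disk, ‖w z‖ ≤ ‖z‖ := fun z hz =>
    Complex.norm_le_norm_of_mapsTo_ball hw (fun u hu => by simpa using (hw1 u hu).le) hw0
      (mem_disk.1 hz)
  have hb := bounds_of_mul_deriv_eq (P := fun z => (β : ℂ) * P z) (hP.const_mul _) (by simp [hP0])
    hs (fun z hz => by
      have := he z hz
      simp only at this
      rw [deriv_const_mul_field, ← this]
      ring) hz
  rw [Complex.re_ofReal_mul, Complex.im_ofReal_mul] at hb
  have hz1 := mem_disk.1 hz
  have hz0 := norm_nonneg z
  refine ⟨lt_of_lt_of_le ?_ hb.1, lt_of_le_of_lt hb.2.1 ?_, hb.2.2⟩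
  · exact Phi_strictMonoOn (by norm_num) ⟨by linarith, by linarith⟩ (by linarith)
  · exact Phi_strictMonoOn ⟨by linarith, by linarith⟩ (by norm_num) hz1

/-- Two continuous functions that agree off the zeros of `z p(z)` agree on the disk. -/
theorem eqOn_disk_of_ne_zero {p A B : ℂ → ℂ} (hp : DifferentiableOn ℂ p disk) (hp0 : p 0 = 1)
    (hA : ContinuousOn A disk) (hB : ContinuousOn B disk)
    (h : ∀ z ∈ disk, z * p z ≠ 0 → A z = B z) : EqOn A B disk := by
  have hq : AnalyticOnNhd ℂ (fun z => z * p z) disk :=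
    (differentiableOn_id.mul hp).analyticOnNhd isOpen_disk
  intro z hz
  have hne : ∀ᶠ u in 𝓝[≠] z, u * p u ≠ 0 := by
    by_contra hc
    have hf : ∃ᶠ u in 𝓝[≠] z, u * p u = 0 := by rwa [Filter.Frequently]
    have hzero := hq.eqOn_zero_of_preconnected_of_frequently_eq_zero
      (convex_ball (0 : ℂ) 1).isPreconnected hz hf
    have hcp : ContinuousAt p 0 :=
      (hp.differentiableAt (isOpen_disk.mem_nhds zero_mem_disk)).continuousAt
    have h1 : ∀ᶠ u in 𝓝[≠] (0 : ℂ), p u ≠ 0 :=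
      (hcp.eventually_ne (by simp [hp0])).filter_mono nhdsWithin_le_nhds
    have h2 : ∀ᶠ u in 𝓝[≠] (0 : ℂ), u ∈ disk :=
      mem_nhdsWithin_of_mem_nhds (isOpen_disk.mem_nhds zero_mem_disk)
    obtain ⟨u, ⟨hu1, hu2⟩, hu3⟩ := ((h1.and h2).and self_mem_nhdsWithin).exists
    exact mul_ne_zero hu3 hu1 (hzero hu2)
  have hd : ∀ᶠ u in 𝓝[≠] z, u ∈ disk := mem_nhdsWithin_of_mem_nhds (isOpen_disk.mem_nhds hz)
  have hAB : A =ᶠ[𝓝[≠] z] B := by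
    filter_upwards [hne, hd] with u hu hu'
    exact h u hu' hu
  have hA' := ((hA z hz).continuousAt (isOpen_disk.mem_nhds hz)).tendsto.mono_left
    (nhdsWithin_le_nhds (s := {z}ᶜ))
  have hB' := ((hB z hz).continuousAt (isOpen_disk.mem_nhds hz)).tendsto.mono_left
    (nhdsWithin_le_nhds (s := {z}ᶜ))
  exact tendsto_nhds_unique (hA'.congr' hAB) hB'

/-- If `z p' / pᵐ⁺¹` is analytic on the disk, then `p` solves a linear differential equation
`p' = (k pᵐ) p` with analytic coefficient, hence has an analytic logarithm and no zeros. -/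
theorem exists_log {p : ℂ → ℂ} {β : ℝ} {m : ℕ} (hβ : 0 < β) (hp : DifferentiableOn ℂ p disk)
    (hp0 : p 0 = 1)
    (hf : DifferentiableOn ℂ (fun z => 1 + (β : ℂ) * (z * deriv p z / p z ^ (m + 1))) disk) :
    ∃ K : ℂ → ℂ, DifferentiableOn ℂ K disk ∧ K 0 = 0 ∧ ∀ z ∈ disk, p z = Complex.exp (K z) := by
  have hβ' : (β : ℂ) ≠ 0 := by exact_mod_cast hβ.ne'
  set F : ℂ → ℂ := fun z => 1 + (β : ℂ) * (z * deriv p z / p z ^ (m + 1)) with hF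
  -- `k` is `z p' / pᵐ⁺¹` divided by `z`, extended analytically to `0`
  set k : ℂ → ℂ := fun z => dslope F 0 z / β with hk
  have hkd : DifferentiableOn ℂ k disk :=
    ((Complex.differentiableOn_dslope (isOpen_disk.mem_nhds zero_mem_disk)).2 hf).div_const _
  have hode : EqOn (deriv p) (fun z => k z * p z ^ m * p z) disk := by
    refine eqOn_disk_of_ne_zero hp hp0 (hp.deriv isOpen_disk).continuousOn
      ((hkd.mul (hp.pow m)).mul hp).continuousOn fun z hz hne => ?_
    obtain ⟨hz0, hpz⟩ := mul_ne_zero_iff.1 hne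
    simp only [hk, hF]
    rw [dslope_of_ne _ hz0, slope_def_field]
    simp
    field_simp
    ring
  obtain ⟨K, hK0, hK⟩ := (hkd.mul (hp.pow m)).isExactOn_ball.with_val_at 0 0
  refine ⟨K, fun z hz => (hK z hz).differentiableAt.differentiableWithinAt, hK0, fun z hz => ?_⟩
  have hder : ∀ u ∈ disk, HasDerivAt (fun u => p u * Complex.exp (-K u)) 0 u := fun u hu => by
    have h1 := (hp.differentiableAt (isOpen_disk.mem_nhds hu)).hasDerivAt
    refine (h1.mul (hK u hu).neg.cexp).congr_deriv ?_
    rw [hode hu]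
    simp
    ring
  -- `p exp (-K)` is constant
  have hconst := (convex_ball (0 : ℂ) 1).is_const_of_fderivWithin_eq_zero (𝕜 := ℂ)
    (f := fun u => p u * Complex.exp (-K u))
    (fun u hu => (hder u hu).differentiableAt.differentiableWithinAt)
    (fun u hu => by
      rw [fderivWithin_of_isOpen Metric.isOpen_ball hu]
      ext
      simp [(hder u hu).deriv])
    hz zero_mem_disk
  simp only [hp0, hK0, neg_zero, Complex.exp_zero, mul_one] at hconst
  rw [Complex.exp_neg] at hconst
  have := Complex.exp_ne_zero (K z)
  field_simp at hconst
  exact hconst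

theorem implication_zero {β : ℝ} (hβ : betaA ≤ β) : Implication 0 β := by
  intro p hp hp0 h
  have hA := Phi_neg_one_mem
  have hA1 := Phi_one_mem
  rw [betaA_eq] at hβ
  refine subordinate_phiNe_of_mapsTo hp hp0 fun z hz => ?_
  have hb := bounds_of_subordinate (P := fun z => p z - 1) (β := β) (hp.sub_const 1) (by simp [hp0])
    (by simpa using h) hz
  obtain ⟨h1, h2, h3⟩ := hb
  simp only [Complex.sub_re, Complex.one_re, Complex.sub_im, Complex.one_im, sub_zero] at h1 h2 h3
  rw [abs_le] at h3
  simp only [rect, mem_ofPred_eq, abs_lt]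
  refine ⟨⟨?_, ?_⟩, ?_, ?_⟩ <;> by_contra! hc <;> nlinarith

theorem implication_one {β : ℝ} (hβ : betaB ≤ β) : Implication 1 β := by
  intro p hp hp0 h
  have hA := Phi_neg_one_mem
  have hA1 := Phi_one_mem
  have hB := abs_lt.1 abs_betaB_sub_lt
  have hβ0 : 0.6809 < β := by linarith
  obtain ⟨K, hK, hK0, hpK⟩ := exists_log (β := β) (m := 0) (by linarith) hp hp0 (by simpa using h.1)
  have hlog := log_five_thirds_mem
  rw [betaB_eq, div_le_iff₀ (by linarith)] at hβ
  refine subordinate_phiNe_of_mapsTo hp hp0 fun z hz => ?_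
  have hb := bounds_of_subordinate (P := K) (β := β) hK hK0 (h.congr fun u hu => ?_) hz
  · obtain ⟨h1, h2, h3⟩ := hb
    have hx2 : (K z).re < Real.log (5 / 3) := by nlinarith
    have hx1 : -0.8058 < (K z).re := by nlinarith
    have hy : |(K z).im| ≤ 0.6272 := by
      rw [abs_mul, abs_of_pos (by linarith)] at h3
      by_contra! hc
      nlinarith
    rw [hpK z hz]
    have he2 : Real.exp (K z).re < 5 / 3 := by
      rwa [← Real.lt_log_iff_exp_lt (by norm_num)]
    have he1 : 0.42 < Real.exp (K z).re := by
      -- `-0.8058 = -log (5/3) - 0.295`, approximately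
      have e1 : Real.exp (-Real.log (5 / 3)) * Real.exp (-0.295) < Real.exp (K z).re := by
        rw [← Real.exp_add]
        exact Real.exp_lt_exp.2 (by linarith)
      rw [Real.exp_neg, Real.exp_log (by norm_num)] at e1
      have e2 := Real.add_one_le_exp (-0.295)
      norm_num at e1 e2 ⊢
      linarith
    have hc1 : 0.803 ≤ Real.cos (K z).im := by
      have := Real.one_sub_sq_div_two_le_cos (x := (K z).im)
      have h4 : (K z).im ^ 2 ≤ 0.6272 ^ 2 := by
        rw [← sq_abs]; exact pow_le_pow_left₀ (abs_nonneg _) hy 2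
      norm_num at h4 ⊢
      linarith
    have hc2 := Real.cos_le_one (K z).im
    have hs : |Real.sin (K z).im| ≤ 0.6272 := Real.abs_sin_le_abs.trans hy
    refine ⟨?_, ?_⟩
    · rw [Complex.exp_re, abs_lt]
      constructor <;> nlinarith
    · rw [Complex.exp_im, abs_mul, abs_of_pos (Real.exp_pos _)]
      nlinarith [abs_nonneg (Real.sin (K z).im)]
  · have hd : deriv p u = deriv K u * p u := by
      have h1 := (hK.differentiableAt (isOpen_disk.mem_nhds hu)).hasDerivAt.cexp
      have h2 : p =ᶠ[𝓝 u] fun z => Complex.exp (K z) :=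
        Filter.eventuallyEq_of_mem (isOpen_disk.mem_nhds hu) hpK
      rw [h2.deriv_eq, h1.deriv, hpK u hu, mul_comm]
    have hne : p u ≠ 0 := by rw [hpK u hu]; exact Complex.exp_ne_zero _
    simp only [hd]
    field_simp

theorem inv_mem_rect {q : ℂ} (h1 : 3 / 5 < q.re) (h2 : q.re < 2) (h3 : |q.im| < 1 / 2) :
    q⁻¹ ∈ rect := by
  have hN : 0 < q.re ^ 2 + q.im ^ 2 := by nlinarith
  have e : Complex.normSq q = q.re ^ 2 + q.im ^ 2 := by rw [Complex.normSq_apply]; ring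
  simp only [rect, mem_ofPred_eq, Complex.inv_re, Complex.inv_im, e]
  have hv : q.im ^ 2 < 1 / 4 := by
    rw [← sq_abs]
    nlinarith [abs_nonneg q.im]
  constructor
  · have hr1 : 1 / 3 < q.re / (q.re ^ 2 + q.im ^ 2) := by
      rw [lt_div_iff₀ hN]; nlinarith
    have hr2 : q.re / (q.re ^ 2 + q.im ^ 2) < 5 / 3 := by
      rw [div_lt_iff₀ hN]; nlinarith
    rw [abs_lt]
    constructor <;> linarith
  · rw [abs_div, abs_neg, abs_of_pos hN, div_lt_iff₀ hN]
    have h4 : 2 * q.re * |q.im| ≤ q.re ^ 2 + q.im ^ 2 := by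
      rw [← sq_abs q.im]; linarith [sq_nonneg (q.re - |q.im|)]
    nlinarith [abs_nonneg q.im]

theorem implication_two {β : ℝ} (hβ : betaC ≤ β) : Implication 2 β := by
  intro p hp hp0 h
  have hA := Phi_neg_one_mem
  have hA1 := Phi_one_mem
  rw [betaC_eq] at hβ
  have hβ0 : 0.8695 < β := by linarith
  obtain ⟨K, -, -, hpK⟩ := exists_log (β := β) (m := 1) (by linarith) hp hp0 (by simpa using h.1)
  have hne : ∀ u ∈ disk, p u ≠ 0 := fun u hu => by rw [hpK u hu]; exact Complex.exp_ne_zero _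
  have hP : DifferentiableOn ℂ (fun z => 1 - (p z)⁻¹) disk := (hp.inv hne).const_sub 1
  refine subordinate_phiNe_of_mapsTo hp hp0 fun z hz => ?_
  have hb := bounds_of_subordinate (β := β) hP (by simp [hp0]) (h.congr fun u hu => ?_) hz
  · obtain ⟨h1, h2, h3⟩ := hb
    have hp' : p z = (1 - (1 - (p z)⁻¹))⁻¹ := by simp
    rw [hp']
    generalize (1 - (p z)⁻¹) = q at *
    rw [abs_le] at h3
    refine inv_mem_rect ?_ ?_ ?_
    · simp only [Complex.sub_re, Complex.one_re]; nlinarith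
    · simp only [Complex.sub_re, Complex.one_re]; nlinarith
    · simp only [Complex.sub_im, Complex.one_im, abs_lt]; constructor <;> nlinarith
  · have h1 := (hp.differentiableAt (isOpen_disk.mem_nhds hu)).hasDerivAt
    have h2 := ((h1.inv (hne u hu)).const_sub 1).deriv
    have h3 : deriv (fun z => 1 - (p z)⁻¹) u = deriv p u / p u ^ 2 := by
      rw [show (fun z => 1 - (p z)⁻¹) = fun z => 1 - p⁻¹ z from rfl, h2]; ring
    simp only [h3]
    ring

/-! ### The extremal functions -/

/-- `Phi` extends to an analytic function `Q` on the disk with `z Q'(z) = φ_RL(z) - 1`. -/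
theorem exists_extremal : ∃ Q : ℂ → ℂ, DifferentiableOn ℂ Q disk ∧ Q 0 = 0 ∧
    (∀ z ∈ disk, z * deriv Q z = phiRL z - 1) ∧
    ∀ x : ℝ, -1 < x → x < 1 → Q x = (Phi x : ℂ) := by
  have hk := (Complex.differentiableOn_dslope (isOpen_disk.mem_nhds zero_mem_disk)).2
    differentiableOn_phiRL
  obtain ⟨Q, hQ0, hQ⟩ := hk.isExactOn_ball.with_val_at 0 0
  have hQm : ∀ z ∈ disk, z * dslope phiRL 0 z = phiRL z - 1 := fun z _ => by
    have := sub_smul_dslope phiRL 0 z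
    simpa using this
  refine ⟨Q, fun z hz => (hQ z hz).differentiableAt.differentiableWithinAt, hQ0, fun z hz => ?_,
    fun x hx hx' => ?_⟩
  · rw [(hQ z hz).deriv, hQm z hz]
  have hxd : (x : ℂ) ∈ disk := by simpa [mem_disk, abs_lt] using And.intro hx hx'
  have hb : ∀ t ∈ Icc (0 : ℝ) 1, -1 < x * t ∧ x * t < 1 := fun t ht => by
    constructor <;> nlinarith [ht.1, ht.2]
  have hd : ∀ t ∈ Icc (0 : ℝ) 1,
      HasDerivAt (fun ζ : ℂ => Q (ζ * x)) (x * dslope phiRL 0 (t * x)) t := fun t ht => by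
    have h2 := HasDerivAt.comp (t : ℂ) (hQ _ (mul_mem_disk hxd ht))
      ((hasDerivAt_id (t : ℂ)).mul_const (x : ℂ))
    refine h2.congr_deriv ?_
    rw [id, one_mul, mul_comm]
  have hval : ∀ t ∈ Ioo (0 : ℝ) 1, (x : ℂ) * dslope phiRL 0 (t * x) = (lemR (x * t) / t : ℝ) :=
      fun t ht => by
    have h1 := hQm _ (mul_mem_disk hxd (Ioo_subset_Icc_self ht))
    obtain ⟨h2, h3⟩ := hb t (Ioo_subset_Icc_self ht)
    have h4 := phiRL_ofReal h2 h3
    rw [show (t : ℂ) * x = (x * t : ℝ) by push_cast; ring, h4] at h1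
    have ht0 : (t : ℂ) ≠ 0 := by exact_mod_cast ht.1.ne'
    rw [show (t : ℂ) * x = (x * t : ℝ) by push_cast; ring]
    push_cast at h1 ⊢
    field_simp
    linear_combination h1
  have hre : ∀ t ∈ Icc (0 : ℝ) 1, HasDerivAt (fun t : ℝ => (Q (t * x)).re)
      (x * dslope phiRL 0 (t * x)).re t := fun t ht => (hd t ht).real_of_complex
  have him : ∀ t ∈ Icc (0 : ℝ) 1, HasDerivAt (fun t : ℝ => (Q (t * x)).im)
      (x * dslope phiRL 0 (t * x)).im t := fun t ht => by
    -- `Im x = Re (-i x)`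
    simpa using ((hd t ht).const_mul (-Complex.I)).real_of_complex
  have hreC : ContinuousOn (fun t : ℝ => (Q (t * x)).re) (Icc 0 1) := fun t ht =>
    (hre t ht).continuousAt.continuousWithinAt
  have himC : ContinuousOn (fun t : ℝ => (Q (t * x)).im) (Icc 0 1) := fun t ht =>
    (him t ht).continuousAt.continuousWithinAt
  have hre' : ∀ t ∈ Ioo (0 : ℝ) 1, HasDerivAt (fun t : ℝ => (Q (t * x)).re) (lemR (x * t) / t) t :=
    fun t ht => (hre t (Ioo_subset_Icc_self ht)).congr_deriv (by rw [hval t ht, Complex.ofReal_re])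
  have him' : ∀ t ∈ Ioo (0 : ℝ) 1, HasDerivAt (fun t : ℝ => (Q (t * x)).im) 0 t :=
    fun t ht => (him t (Ioo_subset_Icc_self ht)).congr_deriv (by rw [hval t ht, Complex.ofReal_im])
  have hPC : ContinuousOn (fun t => Phi (x * t)) (Icc 0 1) :=
    Phi_continuousOn.comp (by fun_prop) fun t ht => ⟨(hb t ht).1.le, (hb t ht).2.le⟩
  have hP' : ∀ t ∈ Ioo (0 : ℝ) 1, HasDerivAt (fun t => Phi (x * t)) (lemR (x * t) / t) t :=
      fun t ht => by
    obtain ⟨h1, h2⟩ := hb t (Ioo_subset_Icc_self ht)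
    refine ((Phi_hasDerivAt h1 h2).comp t ((hasDerivAt_id t).const_mul x)).congr_deriv ?_
    rw [← Phi_deriv_mul h1 h2]
    have := ht.1.ne'
    field_simp
  have r1 := le_of_hasDerivAt_le hreC hPC hre' hP' (fun _ _ => le_rfl) (by simp [hQ0])
  have r2 := le_of_hasDerivAt_le hPC hreC hP' hre' (fun _ _ => le_rfl) (by simp [hQ0])
  have i1 := le_of_hasDerivAt_le himC continuousOn_const him'
    (fun t _ => hasDerivAt_const t (0 : ℝ))
    (fun _ _ => le_rfl) (by simp [hQ0])
  have i2 := le_of_hasDerivAt_le continuousOn_const himC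
    (fun t _ => hasDerivAt_const t (0 : ℝ)) him'
    (fun _ _ => le_rfl) (by simp [hQ0])
  simp only [Complex.ofReal_one, one_mul, mul_one] at r1 r2 i1 i2
  apply Complex.ext
  · simpa using le_antisymm r1 r2
  · simpa using le_antisymm i1 i2

theorem exists_Phi_eq {v : ℝ} (h1 : Phi (-1) < v) (h2 : v < Phi 1) :
    ∃ x, -1 < x ∧ x < 1 ∧ Phi x = v := by
  obtain ⟨x, hx, he⟩ := intermediate_value_Ioo (by norm_num) Phi_continuousOn ⟨h1, h2⟩
  exact ⟨x, hx.1, hx.2, he⟩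

/-- For every `ρ ∈ (0, 1]` the function `P(z) = Q(ρ z) / β`, with `Q` the complex extension of
`Phi`, satisfies `1 + β z P'(z) = φ_RL(ρ z)`. -/
theorem exists_scaled_extremal {β ρ : ℝ} (hβ : 0 < β) (hρ : 0 < ρ) (hρ1 : ρ ≤ 1) :
    ∃ P : ℂ → ℂ, DifferentiableOn ℂ P disk ∧ P 0 = 0 ∧
      Subordinate (fun z => 1 + (β : ℂ) * (z * deriv P z)) phiRL ∧
      (∀ x : ℝ, -1 < x → x < 1 → P x = (Phi (ρ * x) / β : ℝ)) ∧
      ∀ z ∈ disk, β * (P z).re ≤ Phi ρ := by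
  obtain ⟨Q, hQ, hQ0, hQd, hQr⟩ := exists_extremal
  have hβ' : (β : ℂ) ≠ 0 := by exact_mod_cast hβ.ne'
  have hm : ∀ z ∈ disk, (ρ : ℂ) * z ∈ disk := fun z hz => mul_mem_disk hz ⟨hρ.le, hρ1⟩
  have hder : ∀ z ∈ disk, HasDerivAt (fun z => Q (ρ * z) / β) (ρ * deriv Q (ρ * z) / β) z :=
      fun z hz => by
    have h1 := (hQ.differentiableAt (isOpen_disk.mem_nhds (hm z hz))).hasDerivAt
    have h2 := (HasDerivAt.comp z h1 ((hasDerivAt_id z).const_mul (ρ : ℂ))).div_const (β : ℂ)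
    refine h2.congr_deriv ?_
    ring
  have heq : EqOn (fun z => 1 + (β : ℂ) * (z * deriv (fun z => Q (ρ * z) / β) z))
      (fun z => phiRL (ρ * z)) disk := fun z hz => by
    simp only
    rw [(hder z hz).deriv, show phiRL (ρ * z) = 1 + (phiRL (ρ * z) - 1) by ring,
      ← hQd _ (hm z hz)]
    field_simp
  refine ⟨fun z => Q (ρ * z) / β, fun z hz => (hder z hz).differentiableAt.differentiableWithinAt,
    by simp [hQ0], Subordinate.congr ⟨?_, differentiableOn_phiRL, fun z => ρ * z, ?_, by simp,
      fun z hz => mem_disk.1 (hm z hz), fun z hz => rfl⟩ heq, fun x hx hx' => ?_, fun z hz => ?_⟩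
  · exact differentiableOn_phiRL.comp (by fun_prop) hm
  · fun_prop
  · simp only
    rw [← Complex.ofReal_mul, hQr (ρ * x) (by nlinarith) (by nlinarith)]
    push_cast
    rfl
  · have h1 := (bounds_of_mul_deriv_eq hQ hQ0 (w := id) (fun _ _ => le_rfl) hQd (hm z hz)).2.1
    have hn : ‖(ρ : ℂ) * z‖ ≤ ρ := by
      rw [norm_mul, Complex.norm_real, Real.norm_of_nonneg hρ.le]
      nlinarith [mem_disk.1 hz]
    have h2 : Phi ‖(ρ : ℂ) * z‖ ≤ Phi ρ :=
      Phi_strictMonoOn.monotoneOn ⟨by linarith [norm_nonneg ((ρ : ℂ) * z)], hn.trans hρ1⟩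
        ⟨by linarith, hρ1⟩ hn
    rw [Complex.div_ofReal_re, mul_div_cancel₀ _ hβ.ne']
    exact h1.trans h2

theorem not_implication_zero {β : ℝ} (hβ : 0 < β) (h : β < betaA) : ¬ Implication 0 β := by
  intro hI
  rw [betaA_eq] at h
  have hA1 := Phi_one_mem
  obtain ⟨P, hP, hP0, hS, hr, -⟩ := exists_scaled_extremal hβ zero_lt_one le_rfl
  obtain ⟨x, hx, hx', he⟩ := exists_Phi_eq (v := -(2 / 3 * β)) (by linarith) (by linarith)
  have hxd : (x : ℂ) ∈ disk := by simpa [mem_disk, abs_lt] using And.intro hx hx'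
  refine not_subordinate_phiNe hxd (Or.inr ?_)
    (hI (fun z => 1 + P z) (hP.const_add 1) (by simp [hP0]) (by simpa using hS))
  rw [hr x hx hx', one_mul, he, show -(2 / 3 * β) / β = -(2 / 3) by field_simp]
  norm_num

theorem not_implication_one {β : ℝ} (hβ : 0 < β) (h : β < betaB) : ¬ Implication 1 β := by
  intro hI
  have hlog := log_five_thirds_mem
  have hA := Phi_neg_one_mem
  rw [betaB_eq, lt_div_iff₀ (by linarith)] at h
  obtain ⟨P, hP, hP0, hS, hr, -⟩ := exists_scaled_extremal hβ zero_lt_one le_rfl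
  obtain ⟨x, hx, hx', he⟩ := exists_Phi_eq (v := β * Real.log (5 / 3)) (by nlinarith) h
  have hxd : (x : ℂ) ∈ disk := by simpa [mem_disk, abs_lt] using And.intro hx hx'
  refine not_subordinate_phiNe hxd (Or.inl ?_)
    (hI (fun z => Complex.exp (P z)) hP.cexp (by simp [hP0]) (hS.congr fun z hz => ?_))
  · rw [hr x hx hx', one_mul, he, mul_div_cancel_left₀ _ hβ.ne', ← Complex.ofReal_exp,
      Real.exp_log (by norm_num)]
    norm_num
  · have h1 := (hP.differentiableAt (isOpen_disk.mem_nhds hz)).hasDerivAt.cexp.deriv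
    have := Complex.exp_ne_zero (P z)
    simp only [h1]
    field_simp

theorem not_implication_two {β : ℝ} (hβ : 0 < β) (h : β < betaC) : ¬ Implication 2 β := by
  intro hI
  have hA := Phi_neg_one_mem
  rw [betaC_eq] at h
  have hβ' : (β : ℂ) ≠ 0 := by exact_mod_cast hβ.ne'
  -- scaling by `ρ` keeps `Re P` below `1`, away from the pole of `1 / (1 - P)`
  obtain ⟨v, hv1, hv2⟩ := exists_between (show 2 / 5 * β < min β (Phi 1) from
    lt_min (by linarith) (by linarith))
  obtain ⟨ρ, hρ, hρ1, hρv⟩ := exists_Phi_eq (v := v) (by linarith) (hv2.trans_le (min_le_right _ _))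
  obtain ⟨x, hx, hx1, hxv⟩ := exists_Phi_eq (v := 2 / 5 * β) (by linarith) (by linarith)
  have hρm : ρ ∈ Icc (-1 : ℝ) 1 := ⟨hρ.le, hρ1.le⟩
  have hxm : x ∈ Icc (-1 : ℝ) 1 := ⟨hx.le, hx1.le⟩
  have h0m : (0 : ℝ) ∈ Icc (-1 : ℝ) 1 := by norm_num
  have hx0 : 0 < x := by
    rw [← Phi_strictMonoOn.lt_iff_lt h0m hxm, Phi_zero, hxv]; positivity
  have hxρ : x < ρ := by
    rw [← Phi_strictMonoOn.lt_iff_lt hxm hρm, hxv, hρv]; exact hv1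
  have hρ0 : 0 < ρ := hx0.trans hxρ
  obtain ⟨P, hP, hP0, hS, hr, hre⟩ := exists_scaled_extremal hβ hρ0 hρ1.le
  have hne : ∀ z ∈ disk, 1 - P z ≠ 0 := fun z hz h0 => by
    have h1 := hre z hz
    rw [← sub_eq_zero.1 h0, Complex.one_re, hρv, mul_one] at h1
    linarith [hv2.trans_le (min_le_left _ _)]
  have hy : -1 < x / ρ := by linarith [div_pos hx0 hρ0]
  have hy1 : x / ρ < 1 := (div_lt_one hρ0).2 hxρ
  have hyd : ((x / ρ : ℝ) : ℂ) ∈ disk := by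
    rw [mem_disk, Complex.norm_real, Real.norm_eq_abs, abs_lt]
    exact ⟨hy, hy1⟩
  refine not_subordinate_phiNe hyd (Or.inl ?_)
    (hI (fun z => (1 - P z)⁻¹) ((hP.const_sub 1).inv hne) (by simp [hP0])
      (hS.congr fun z hz => ?_))
  · rw [hr _ hy hy1, mul_div_cancel₀ _ hρ0.ne', hxv, mul_div_cancel_right₀ _ hβ.ne']
    norm_num
  · have h1 := (hP.differentiableAt (isOpen_disk.mem_nhds hz)).hasDerivAt
    have h2 : deriv (fun z => (1 - P z)⁻¹) z = deriv P z / (1 - P z) ^ 2 := by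
      have := ((h1.const_sub 1).inv (hne z hz)).deriv
      rw [neg_neg] at this
      exact this
    have h3 := hne z hz
    simp only [h2]
    field_simp

end Nephroid

end

/-- Sharp bounds on `β` for which `1 + β z p' / p^j ≺ φ_RL` implies `p ≺ φ_Ne`, `j = 0, 1, 2`,
with the numerical values of the bounds to six decimal places. -/
theorem mainTheorem2 :
    ((∀ β : ℝ, Nephroid.betaA ≤ β → Nephroid.Implication 0 β) ∧
      (∀ β : ℝ, 0 < β → β < Nephroid.betaA → ¬ Nephroid.Implication 0 β) ∧
      |Nephroid.betaA - 0.822832| < 0.0000005) ∧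
    ((∀ β : ℝ, Nephroid.betaB ≤ β → Nephroid.Implication 1 β) ∧
      (∀ β : ℝ, 0 < β → β < Nephroid.betaB → ¬ Nephroid.Implication 1 β) ∧
      |Nephroid.betaB - 0.680906| < 0.0000005) ∧
    ((∀ β : ℝ, Nephroid.betaC ≤ β → Nephroid.Implication 2 β) ∧
      (∀ β : ℝ, 0 < β → β < Nephroid.betaC → ¬ Nephroid.Implication 2 β) ∧
      |Nephroid.betaC - 0.869561| < 0.0000005) :=
    ⟨⟨fun _ h => Nephroid.implication_zero h, fun _ h0 h => Nephroid.not_implication_zero h0 h,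
      Nephroid.abs_betaA_sub_lt⟩,
    ⟨fun _ h => Nephroid.implication_one h, fun _ h0 h => Nephroid.not_implication_one h0 h,
      Nephroid.abs_betaB_sub_lt⟩,
    ⟨fun _ h => Nephroid.implication_two h, fun _ h0 h => Nephroid.not_implication_two h0 h,
      Nephroid.abs_betaC_sub_lt⟩⟩
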